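/- Let $G$ be a finite simple connected graph with chromatic number $\chi(G)=3$ that is not isomorphic to the cycle $C_7$ on $7$ vertices. Then there is a proper $3$-coloring $c : V(G)\to\{1,2,3\}$ (that is, $c(u)\neq c(v)$ whenever $u$ and $v$ are adjacent) such that every vertex $x$ of $G$ is the first vertex of a colorful path, that is, of a path $x\,y\,z$ in $G$ on three distinct vertices, with $\{x,y\}$ and $\{y,z\}$ edges of $G$, whose three vertices receive three pairwise distinct colors. -/

import Mathlib

namespace SimpleGraph

variable {V : Type*} {G : SimpleGraph V}

/-- A rainbow path for a proper coloring `c`: a path (no repeated vertices) whose vertices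
have pairwise distinct colors. -/
def IsRainbowPath {α : Type*} (c : G.Coloring α) {u v : V} (p : G.Walk u v) : Prop :=
  p.IsPath ∧ (p.support.map c).Nodup

/-- A colorful path for a proper `k`-coloring `c`: a rainbow path on exactly `k` vertices. -/
def IsColorfulPath {k : ℕ} (c : G.Coloring (Fin k)) {u v : V} (p : G.Walk u v) : Prop :=
  IsRainbowPath c p ∧ p.support.length = k

end SimpleGraph

/-! Read the colors in `ZMod 3` and orient each edge towards the color that is one larger. Three
distinct colors on a path mean that it is directed one way or the other, so the task is to put every
vertex at an end of a directed path with two arcs (`Good`). Lowering by one a set closed under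
in-neighbors keeps the coloring proper and only reverses the arcs leaving the set.

Suppose no coloring works. By lowering, every vertex can be made to reach a chosen root; the root
must then be a sink, and no coloring has a directed cycle (`exists_good_of_transGen`). Take a
directed path with `L` arcs to the only sink such that no rooted coloring has `L + 1`. A bad vertex
`x` is adjacent to the root, and lowering around it makes `x` the new root; as the path cannot grow,
its first vertex is adjacent to `x` (`IsRooted.advance`). Iterating gives an infinite sequence of
roots `q k` with rigid adjacencies (`IsRotation`), and `L` is `2` modulo `3`.

An edge leaving this sequence allows a local recoloring that makes all vertices good, apart from one
exceptional configuration (`exists_good_of_adj`). If only the exception occurs, `q` has period `L +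
2` and visits every vertex; `L ≥ 8` is contradictory and `L = 5` gives the 7-cycle
(`exists_good_or_iso`). -/

namespace ThreeColoring

open SimpleGraph Relation

variable {V : Type*} {G : SimpleGraph V}

/-! ### Colorings as orientations. -/

/-- `c` is a proper coloring of `G` with colors in `ZMod 3`. -/
def Proper (G : SimpleGraph V) (c : V → ZMod 3) : Prop :=
  ∀ ⦃u v⦄, G.Adj u v → c u ≠ c v

/-- The orientation of `G` defined by a coloring: `u → v` if the color increases by one. -/
def Arc (G : SimpleGraph V) (c : V → ZMod 3) (u v : V) : Prop :=
  G.Adj u v ∧ c v = c u + 1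

/-- `x` starts or ends a directed path with two arcs, i.e. it starts a colorful path. -/
def Good (G : SimpleGraph V) (c : V → ZMod 3) (x : V) : Prop :=
  (∃ y z, Arc G c x y ∧ Arc G c y z) ∨ ∃ y z, Arc G c z y ∧ Arc G c y x

theorem eq_add_one_or_eq_add_one {a b : ZMod 3} (h : a ≠ b) : b = a + 1 ∨ a = b + 1 := by
  revert a b; decide

theorem three_eq_zero : (3 : ZMod 3) = 0 := rfl

theorem Arc.ne_add_one {c : V → ZMod 3} {u v : V} (h : Arc G c u v) : c u ≠ c v + 1 := by
  rw [h.2]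
  generalize c u = a
  revert a; decide

theorem Proper.arc_or_arc {c : V → ZMod 3} (hc : Proper G c) {u v : V} (h : G.Adj u v) :
    Arc G c u v ∨ Arc G c v u := by
  rcases eq_add_one_or_eq_add_one (hc h) with h' | h'
  · exact Or.inl ⟨h, h'⟩
  · exact Or.inr ⟨h.symm, h'⟩

theorem Proper.of_arc_or_arc {c : V → ZMod 3}
    (hc : ∀ u v, G.Adj u v → Arc G c u v ∨ Arc G c v u) : Proper G c := by
  intro u v h e
  rcases hc u v h with h' | h'
  · have := h'.2; rw [e] at this; simp at this
  · have := h'.2; rw [e] at this; simp at this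

/-- A `ZMod 3`-coloring in which all vertices are good gives the required coloring. -/
theorem exists_colorful_of_good {c : V → ZMod 3} (hc : Proper G c) (hg : ∀ x, Good G c x) :
    ∃ c : G.Coloring (Fin 3), ∀ x : V, ∃ (y : V) (p : G.Walk x y), IsColorfulPath c p := by
  refine ⟨Coloring.mk (fun v => (c v : Fin 3)) (fun {u v} h => hc h), fun x => ?_⟩
  have key : ∀ y z, G.Adj x y → G.Adj y z → c x ≠ c y → c y ≠ c z → c x ≠ c z →
      ∃ (y : V) (p : G.Walk x y),
        IsColorfulPath (Coloring.mk (fun v => (c v : Fin 3)) (fun {u v} h => hc h)) p := by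
    intro y z hxy hyz h1 h2 h3
    have hxz : x ≠ z := fun h => h3 (by rw [h])
    refine ⟨z, Walk.cons hxy (Walk.cons hyz Walk.nil), ⟨?_, ?_⟩, ?_⟩
    · simp [hyz.ne, hxy.ne, hxz]
    · simp only [Walk.support_cons, Walk.support_nil, List.map_cons, List.map_nil,
        List.nodup_cons, List.mem_cons, List.not_mem_nil, or_false, not_or, not_false_eq_true,
        List.nodup_nil, and_true]
      exact ⟨⟨h1, h3⟩, h2⟩
    · simp
  have hne : ∀ a b : ZMod 3, b = a + 1 + 1 → a ≠ b := by decide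
  rcases hg x with ⟨y, z, h1, h2⟩ | ⟨y, z, h1, h2⟩
  · exact key y z h1.1 h2.1 (hc h1.1) (hc h2.1) (hne _ _ (by rw [h2.2, h1.2]))
  · exact key y z h2.1.symm h1.1.symm (hc h2.1).symm (hc h1.1).symm
      (hne _ _ (by rw [h2.2, h1.2])).symm

/-! ### Lowering in-closed sets and reaching a root. -/

open Classical in
/-- Lower the colors of the vertices of `A` by one. -/
noncomputable def lower (A : Set V) (c : V → ZMod 3) (v : V) : ZMod 3 :=
  if v ∈ A then c v - 1 else c v

theorem lower_of_mem {A : Set V} {c : V → ZMod 3} {v : V} (h : v ∈ A) :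
    lower A c v = c v - 1 := if_pos h

theorem lower_of_notMem {A : Set V} {c : V → ZMod 3} {v : V} (h : v ∉ A) :
    lower A c v = c v := if_neg h

theorem Arc.lower_of_mem {A : Set V} {c : V → ZMod 3} {u v : V} (h : Arc G c u v) (hu : u ∈ A)
    (hv : v ∈ A) : Arc G (lower A c) u v := by
  refine ⟨h.1, ?_⟩
  rw [ThreeColoring.lower_of_mem hu, ThreeColoring.lower_of_mem hv, h.2]; ring

theorem Arc.lower_of_notMem {A : Set V} {c : V → ZMod 3} {u v : V} (h : Arc G c u v)
    (hu : u ∉ A) (hv : v ∉ A) : Arc G (lower A c) u v := by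
  refine ⟨h.1, ?_⟩
  rw [ThreeColoring.lower_of_notMem hu, ThreeColoring.lower_of_notMem hv, h.2]

theorem Arc.lower_symm {A : Set V} {c : V → ZMod 3} {u v : V} (h : Arc G c u v)
    (hu : u ∈ A) (hv : v ∉ A) : Arc G (lower A c) v u := by
  refine ⟨h.1.symm, ?_⟩
  rw [ThreeColoring.lower_of_mem hu, ThreeColoring.lower_of_notMem hv, h.2]
  linear_combination -three_eq_zero

/-- Lowering a set that is closed under in-neighbors reverses the arcs leaving it. -/
theorem Proper.lower {A : Set V} {c : V → ZMod 3} (hc : Proper G c)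
    (hA : ∀ u v, Arc G c u v → v ∈ A → u ∈ A) : Proper G (lower A c) := by
  have key : ∀ u v, Arc G c u v → Arc G (ThreeColoring.lower A c) u v ∨
      Arc G (ThreeColoring.lower A c) v u := by
    intro u v h
    by_cases hv : v ∈ A
    · exact Or.inl (h.lower_of_mem (hA u v h hv) hv)
    · by_cases hu : u ∈ A
      · exact Or.inr (h.lower_symm hu hv)
      · exact Or.inl (h.lower_of_notMem hu hv)
  refine Proper.of_arc_or_arc fun u v h => ?_
  rcases hc.arc_or_arc h with huv | hvu
  · exact key u v huv
  · exact (key v u hvu).symm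

/-- Any coloring can be changed so that every vertex has a directed path to `r`, while the
arcs already lying on directed paths to `r` are kept. -/
theorem exists_proper_reaching [Finite V] (hG : G.Connected) (r : V) {c : V → ZMod 3}
    (hc : Proper G c) : ∃ c', Proper G c' ∧ (∀ u, ReflTransGen (Arc G c') u r) ∧
      ∀ u v, Arc G c u v → ReflTransGen (Arc G c) v r → Arc G c' u v := by
  induction hn : Set.ncard {u | ¬ ReflTransGen (Arc G c) u r} using Nat.strong_induction_on
    generalizing c with
  | _ n ih =>
  by_cases hall : ∀ u, ReflTransGen (Arc G c) u r
  · exact ⟨c, hc, hall, fun u v h _ => h⟩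
  · set A : Set V := {u | ReflTransGen (Arc G c) u r} with hAdef
    have hrA : r ∈ A := ReflTransGen.refl
    have hA : ∀ u v, Arc G c u v → v ∈ A → u ∈ A := fun u v h hv => ReflTransGen.head h hv
    have hkeep : ∀ u v, Arc G c u v → v ∈ A → Arc G (lower A c) u v :=
      fun u v h hv => h.lower_of_mem (hA u v h hv) hv
    have hmono : ∀ u, u ∈ A → ReflTransGen (Arc G (lower A c)) u r := by
      intro u hu
      induction hu using ReflTransGen.head_induction_on with
      | refl => exact ReflTransGen.refl
      | head h h' ih' => exact ReflTransGen.head (hkeep _ _ h h') ih'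
    push Not at hall
    obtain ⟨z, hz⟩ := hall
    obtain ⟨u, hu, w, hw, huw⟩ : ∃ u ∈ A, ∃ w ∉ A, G.Adj u w := by
      obtain ⟨p⟩ := hG.preconnected r z
      obtain ⟨d, -, hd1, hd2⟩ := p.exists_boundary_dart A hrA hz
      exact ⟨d.fst, hd1, d.snd, hd2, d.adj⟩
    have harc : Arc G c u w := by
      rcases hc.arc_or_arc huw with h | h
      · exact h
      · exact absurd (hA _ _ h hu) hw
    -- The edge leaving `A` is reversed by the lowering, so `w` newly reaches `r` and the count
    -- drops.
    have hw' : ReflTransGen (Arc G (lower A c)) w r :=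
      ReflTransGen.head (harc.lower_symm hu hw) (hmono u hu)
    have hlt : Set.ncard {u | ¬ ReflTransGen (Arc G (lower A c)) u r} < n := by
      rw [← hn]
      refine Set.ncard_lt_ncard ⟨fun v hv hv' => hv (hmono v hv'), fun hsub => ?_⟩
        (Set.toFinite _)
      exact hsub (show w ∈ {u | ¬ ReflTransGen (Arc G c) u r} from hw) hw'
    obtain ⟨c', h1, h2, h3⟩ := ih _ hlt (hc.lower hA) rfl
    exact ⟨c', h1, h2, fun a b hab hb => h3 a b (hkeep a b hab hb) (hmono b hb)⟩

theorem good_of_forall_exists_arc {c : V → ZMod 3} (h : ∀ v, ∃ w, Arc G c v w) (x : V) :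
    Good G c x := by
  obtain ⟨y, hy⟩ := h x
  obtain ⟨z, hz⟩ := h y
  exact Or.inl ⟨y, z, hy, hz⟩

theorem exists_arc_of_reflTransGen {c : V → ZMod 3} {u r : V}
    (h : ReflTransGen (Arc G c) u r) (hne : u ≠ r) : ∃ w, Arc G c u w := by
  rcases ReflTransGen.cases_head h with h | ⟨w, hw, -⟩
  · exact absurd h hne
  · exact ⟨w, hw⟩

/-- If some coloring orients a cycle cyclically, then all vertices can be made good. -/
theorem exists_good_of_transGen [Finite V] (hG : G.Connected) {r : V} {c : V → ZMod 3}
    (hc : Proper G c) (hr : TransGen (Arc G c) r r) :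
    ∃ c', Proper G c' ∧ ∀ x, Good G c' x := by
  obtain ⟨c', h1, h2, h3⟩ := exists_proper_reaching hG r hc
  refine ⟨c', h1, good_of_forall_exists_arc fun v => ?_⟩
  by_cases hv : v = r
  · subst hv
    obtain ⟨w, hw, hw'⟩ := TransGen.head'_iff.1 hr
    exact ⟨w, h3 _ _ hw hw'⟩
  · exact exists_arc_of_reflTransGen (h2 v) hv

/-! ### Colorings with a single sink. -/

/-- A coloring together with a directed path `p 0 → ⋯ → p L` to its only sink `p L`. -/
structure IsRooted (G : SimpleGraph V) (L : ℕ) (c : V → ZMod 3) (p : ℕ → V) : Prop where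
  proper : Proper G c
  exists_arc : ∀ v, v ≠ p L → ∃ w, Arc G c v w
  not_arc : ∀ w, ¬ Arc G c (p L) w
  path : ∀ i < L, Arc G c (p i) (p (i + 1))

theorem transGen_of_path {c : V → ZMod 3} {p : ℕ → V} {L : ℕ}
    (hp : ∀ i < L, Arc G c (p i) (p (i + 1))) {i j : ℕ} (hij : i < j) (hj : j ≤ L) :
    TransGen (Arc G c) (p i) (p j) := by
  induction j, hij using Nat.le_induction with
  | base => exact TransGen.single (hp i (by lia))
  | succ j hij ih => exact TransGen.tail (ih (by lia)) (hp j (by lia))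

/-- Without a good coloring, directed paths have fewer arcs than `G` has vertices. -/
theorem IsRooted.lt_card [Finite V] (hG : G.Connected)
    (hbad : ∀ c, Proper G c → ∃ x, ¬ Good G c x) {L : ℕ} {c : V → ZMod 3} {p : ℕ → V}
    (h : IsRooted G L c p) : L < Nat.card V := by
  by_contra hL
  push Not at hL
  -- A repeated vertex would close a directed cycle.
  have hcyc : ∀ i j, i < j → j ≤ L → p i ≠ p j := by
    intro i j hij hj e
    have ht := transGen_of_path h.path hij hj
    rw [← e] at ht
    obtain ⟨c', h1, h2⟩ := exists_good_of_transGen hG h.proper ht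
    obtain ⟨x, hx⟩ := hbad c' h1
    exact hx (h2 x)
  have hinj : Function.Injective (fun i : Fin (L + 1) => p i) := by
    intro i j e
    by_contra hne
    rcases lt_or_gt_of_ne (fun h => hne (Fin.ext h) : (i : ℕ) ≠ j) with hlt | hlt
    · exact hcyc i j hlt (by lia) e
    · exact hcyc j i hlt (by lia) e.symm
  have := Nat.card_le_card_of_injective _ hinj
  simp at this
  lia

/-- A connected graph that is not bipartite has a rooted coloring with a path of length three,
unless it has a good coloring. -/
theorem exists_isRooted [Finite V] (hG : G.Connected)
    (hbad : ∀ c, Proper G c → ∃ x, ¬ Good G c x) (h2 : ¬ G.Colorable 2)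
    {c : V → ZMod 3} (hc : Proper G c) : ∃ c p, IsRooted G 3 c p := by
  classical
  obtain ⟨r⟩ := hG.nonempty
  obtain ⟨c, hc, hr, -⟩ := exists_proper_reaching hG r hc
  -- If the root also had an out-arc, every vertex would have one and all would be good.
  have hsink : ∀ w, ¬ Arc G c r w := by
    intro w hw
    obtain ⟨x, hx⟩ := hbad c hc
    refine hx (good_of_forall_exists_arc (fun v => ?_) x)
    by_cases hv : v = r
    · exact ⟨w, hv ▸ hw⟩
    · exact exists_arc_of_reflTransGen (hr v) hv
  by_contra hno
  have hlong : ∀ a b d, Arc G c a b → Arc G c b d → ¬ Arc G c d r := by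
    intro a b d hab hbd hdr
    refine hno ⟨c, fun i => if i = 0 then a else if i = 1 then b else if i = 2 then d else r,
      hc, fun v hv => exists_arc_of_reflTransGen (hr v) (by simpa using hv), ?_, ?_⟩
    · simpa using hsink
    · intro i hi
      interval_cases i <;> simpa
  have harc : ∀ u v, Arc G c u v → v = r ∨ Arc G c v r := by
    intro u v
    induction hr v using ReflTransGen.head_induction_on generalizing u with
    | refl => exact fun _ => Or.inl rfl
    | head h _ ih =>
      intro huv
      rcases ih _ h with rfl | h'
      · exact Or.inr h
      · exact absurd h' (hlong _ _ _ huv h)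
  -- Without directed paths of three arcs to `r`, every arc ends at `r` or at an in-neighbor of `r`.
  -- Hence each edge has exactly one end of color `c r - 1`, which is a 2-coloring.
  have hcol : ∀ u v, Arc G c u v → (c u = c r - 1 ↔ ¬ c v = c r - 1) := by
    intro u v huv
    have := huv.2
    rcases harc u v huv with rfl | h
    · rw [this]
      generalize c u = a
      revert a; decide
    · rw [h.2, this]
      generalize c u = a
      revert a; decide
  refine h2 ⟨Coloring.mk (fun v => if c v = c r - 1 then 0 else 1) fun {u v} h => ?_⟩
  rcases hc.arc_or_arc h with h | h
  · have := hcol _ _ h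
    by_cases hu : c u = c r - 1 <;> simp_all
  · have := hcol _ _ h
    by_cases hu : c u = c r - 1 <;> simp_all

/-! ### Stuck vertices and moving the root. -/

/-- `x` is adjacent to the sink `r`, and its other neighbors are sources. -/
structure IsStuck (G : SimpleGraph V) (c : V → ZMod 3) (r x : V) : Prop where
  arc : Arc G c x r
  source : ∀ y, G.Adj y x → y ≠ r → ∀ w, G.Adj y w → c w = c y + 1

/-- The path obtained from `p` by dropping its first vertex and appending `x`. -/
def advance (L : ℕ) (p : ℕ → V) (x : V) (i : ℕ) : V := if i < L then p (i + 1) else x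

/-- A vertex that is not good in a rooted coloring is stuck. -/
theorem IsRooted.isStuck {L : ℕ} {c : V → ZMod 3} {p : ℕ → V} (h : IsRooted G L c p)
    (hL : 2 ≤ L) {x : V} (hx : ¬ Good G c x) : IsStuck G c (p L) x := by
  have hxr : x ≠ p L := by
    rintro rfl
    have h1 := h.path (L - 2) (by lia)
    have h2 := h.path (L - 1) (by lia)
    rw [show L - 2 + 1 = L - 1 by lia] at h1
    rw [show L - 1 + 1 = L by lia] at h2
    exact hx (Or.inr ⟨_, _, h1, h2⟩)
  have hout : ∀ w, Arc G c x w → w = p L := by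
    intro w hw
    by_contra hne
    obtain ⟨z, hz⟩ := h.exists_arc w hne
    exact hx (Or.inl ⟨w, z, hw, hz⟩)
  obtain ⟨w, hw⟩ := h.exists_arc x hxr
  have hxL : Arc G c x (p L) := hout w hw ▸ hw
  refine ⟨hxL, fun y hy hne w hw => ?_⟩
  rcases h.proper.arc_or_arc hy with h' | hxy
  · rcases h.proper.arc_or_arc hw with h'' | h''
    · exact h''.2
    · exact absurd (Or.inr ⟨y, w, h'', h'⟩) hx
  · exact absurd (hout y hxy) hne

/-- The closed neighborhood of `x` without `r`. -/
def nearSet (G : SimpleGraph V) (r x : V) : Set V := {v | v = x ∨ G.Adj v x ∧ v ≠ r}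

/-- In-neighbors of `x` lie in the set because `r` is a sink, and its other members are sources,
hence have no in-neighbors at all. -/
theorem IsStuck.nearSet_closed {c : V → ZMod 3} {r x : V} (h : IsStuck G c r x)
    (hr : ∀ w, ¬ Arc G c r w) : ∀ u v, Arc G c u v → v ∈ nearSet G r x → u ∈ nearSet G r x := by
  rintro u v huv (rfl | ⟨hv, hne⟩)
  · exact Or.inr ⟨huv.1, fun e => hr v (e ▸ huv)⟩
  · exact absurd (h.source v hv hne u huv.1.symm) huv.ne_add_one

/-- Lowering around a stuck vertex makes it the only sink; for a longest path this forces its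
first vertex to be adjacent to the stuck vertex. -/
theorem IsRooted.advance {L : ℕ} {c : V → ZMod 3} {p : ℕ → V} (h : IsRooted G L c p)
    (hL : 3 ≤ L) {x : V} (hx : IsStuck G c (p L) x)
    (hmax : ∀ c p, ¬ IsRooted G (L + 1) c p) :
    IsRooted G L (lower (nearSet G (p L) x) c) (advance L p x) ∧ G.Adj (p 0) x := by
  set A := nearSet G (p L) x with hAdef
  have hA := hx.nearSet_closed h.not_arc
  have hxA : x ∈ A := Or.inl rfl
  have hxL : x ≠ p L := hx.arc.1.ne
  have hLA : p L ∉ A := by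
    rintro (e | e)
    · exact hxL e.symm
    · exact e.2 rfl
  have hproper := h.proper.lower hA
  have hex : ∀ v, v ≠ x → ∃ w, Arc G (lower A c) v w := by
    intro v hv
    by_cases hvL : v = p L
    · exact ⟨x, hvL ▸ hx.arc.lower_symm hxA hLA⟩
    · by_cases hvA : v ∈ A
      · obtain ⟨hvx, -⟩ := hvA.resolve_left hv
        exact ⟨x, Arc.lower_of_mem ⟨hvx, hx.source v hvx hvL x hvx⟩ hvA hxA⟩
      · obtain ⟨w, hw⟩ := h.exists_arc v hvL
        exact ⟨w, hw.lower_of_notMem hvA fun hwA => hvA (hA _ _ hw hwA)⟩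
  have hsink : ∀ w, ¬ Arc G (lower A c) x w := by
    intro w hw
    by_cases hwL : w = p L
    · subst hwL
      exact (hx.arc.lower_symm hxA hLA).ne_add_one hw.2
    · have hwA : w ∈ A := Or.inr ⟨hw.1.symm, hwL⟩
      exact (Arc.lower_of_mem (c := c)
        ⟨hw.1.symm, hx.source w hw.1.symm hwL x hw.1.symm⟩ hwA hxA).ne_add_one hw.2
  -- An earlier occurrence of `x` would have a path successor that is a source or the sink. At
  -- position `L - 1`, its predecessor would be a source, yet it is entered from `p (L - 2 - 1)`;
  -- this is where `3 ≤ L` enters.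
  have hpx : ∀ i < L, p i ≠ x := by
    intro i hi e
    have h1 := h.path i hi
    have hiL : i + 1 = L := by
      by_contra hne
      by_cases hpL : p (i + 1) = p L
      · exact h.not_arc _ (hpL ▸ h.path (i + 1) (by lia))
      · rw [e] at h1
        have := hx.source _ h1.1.symm hpL x h1.1.symm
        exact h1.ne_add_one this
    have h2 := h.path (i - 1) (by lia)
    have h3 := h.path (i - 2) (by lia)
    rw [show i - 1 + 1 = i by lia, e] at h2
    rw [show i - 2 + 1 = i - 1 by lia] at h3
    have hne : p (i - 1) ≠ p L := fun e' => h.not_arc _ (e' ▸ h2)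
    exact h3.ne_add_one (hx.source _ h2.1 hne _ h3.1.symm)
  have hpA : ∀ i, 0 < i → i ≤ L → p i ∉ A := by
    intro i hi hiL hmem
    rcases hiL.eq_or_lt with rfl | hlt
    · exact hLA hmem
    · obtain ⟨h1, h2⟩ := hmem.resolve_left (hpx i hlt)
      have h3 := h.path (i - 1) (by lia)
      rw [show i - 1 + 1 = i by lia] at h3
      exact h3.ne_add_one (hx.source _ h1 h2 _ h3.1.symm)
  have hLx : Arc G (lower A c) (p L) x := hx.arc.lower_symm hxA hLA
  constructor
  · refine ⟨hproper, ?_, ?_, ?_⟩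
    · simpa [ThreeColoring.advance] using hex
    · simpa [ThreeColoring.advance] using hsink
    · intro i hi
      by_cases hi' : i + 1 < L
      · simp only [ThreeColoring.advance, hi, hi', if_true]
        exact (h.path (i + 1) hi').lower_of_notMem (hpA _ (by lia) hi) (hpA _ (by lia) hi')
      · obtain rfl : L = i + 1 := by lia
        simpa [ThreeColoring.advance] using hLx
  · by_contra h0
    -- If `p 0` is not adjacent to `x`, the whole path survives the lowering and `x` can be appended
    -- to it.
    have h0A : ∀ i ≤ L, p i ∉ A := by
      intro i hi
      rcases Nat.eq_zero_or_pos i with rfl | hpos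
      · rintro (e | e)
        · exact hpx 0 (by lia) e
        · exact h0 e.1
      · exact hpA i hpos hi
    refine hmax (lower A c) (fun i => if i ≤ L then p i else x) ⟨hproper, ?_, ?_, ?_⟩
    · simpa using hex
    · simpa using hsink
    · intro i hi
      by_cases hi' : i + 1 ≤ L
      · simp only [hi', show i ≤ L by lia, if_true]
        exact (h.path i hi').lower_of_notMem (h0A _ (by lia)) (h0A _ hi')
      · obtain rfl : L = i := by lia
        simpa using hLx

/-! ### The infinite sequence of roots. -/

open Classical in
/-- A sequence of vertices `q k` and colorings `D k` such that the neighbors of `q (k + 1)` are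
sources for `D k`, and `D (k + 1)` arises from `D k` by lowering them. -/
structure IsRotation (G : SimpleGraph V) (L : ℕ) (q : ℕ → V) (D : ℕ → V → ZMod 3) : Prop where
  proper : ∀ k, Proper G (D k)
  source : ∀ k v w, G.Adj v (q (k + 1)) → G.Adj v w → D k w = D k v + 1
  succ : ∀ k v, D (k + 1) v = if G.Adj v (q (k + 1)) then D k v - 1 else D k v
  path : ∀ k i, k ≤ i + L → i + 2 ≤ k → D k (q (i + 1)) = D k (q i) + 1
  adj_succ : ∀ k, G.Adj (q k) (q (k + 1))
  adj_add : ∀ k, G.Adj (q k) (q (k + L + 1))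
  exists_arc : ∀ k v, v ≠ q k → ¬ G.Adj v (q k) → ∃ w, Arc G (D k) v w

/-- Path lengths are bounded by `IsRooted.lt_card`, so some attainable `L` has no successor. For
this `L`, every rooted coloring has a stuck vertex and `IsRooted.advance` can be repeated forever.
-/
theorem exists_isRooted_seq [Finite V] (hG : G.Connected)
    (hbad : ∀ c, Proper G c → ∃ x, ¬ Good G c x) (h2 : ¬ G.Colorable 2)
    {c : V → ZMod 3} (hc : Proper G c) :
    ∃ L, 3 ≤ L ∧ ∃ (c : ℕ → V → ZMod 3) (p : ℕ → ℕ → V), ∀ k, IsRooted G L (c k) (p k) ∧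
      ∃ x, IsStuck G (c k) (p k L) x ∧ G.Adj (p k 0) x ∧
        c (k + 1) = lower (nearSet G (p k L) x) (c k) ∧ p (k + 1) = advance L (p k) x := by
  obtain ⟨L, hL, ⟨c₀, p₀, h₀⟩, hmax⟩ : ∃ L, 3 ≤ L ∧ (∃ c p, IsRooted G L c p) ∧
      ∀ c p, ¬ IsRooted G (L + 1) c p := by
    by_contra hno
    push Not at hno
    have hall : ∀ L, 3 ≤ L → ∃ c p, IsRooted G L c p := by
      intro L hL
      induction L, hL using Nat.le_induction with
      | base => exact exists_isRooted hG hbad h2 hc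
      | succ L hL ih =>
        exact hno L hL ih
    obtain ⟨c, p, h⟩ := hall (Nat.card V + 3) (by lia)
    have := h.lt_card hG hbad
    lia
  have step : ∀ s : {s : (V → ZMod 3) × (ℕ → V) // IsRooted G L s.1 s.2},
      ∃ t : {s : (V → ZMod 3) × (ℕ → V) // IsRooted G L s.1 s.2},
      ∃ x, IsStuck G s.1.1 (s.1.2 L) x ∧ G.Adj (s.1.2 0) x ∧
        t.1.1 = lower (nearSet G (s.1.2 L) x) s.1.1 ∧ t.1.2 = advance L s.1.2 x := by
    rintro ⟨⟨c, p⟩, h⟩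
    obtain ⟨x, hx⟩ := hbad c h.proper
    have hs := h.isStuck (by lia) hx
    obtain ⟨h1, h2⟩ := h.advance hL hs hmax
    exact ⟨⟨⟨_, _⟩, h1⟩, x, hs, h2, rfl, rfl⟩
  choose f hf using step
  let s : ℕ → {s : (V → ZMod 3) × (ℕ → V) // IsRooted G L s.1 s.2} :=
    fun k => Nat.rec ⟨(c₀, p₀), h₀⟩ (fun _ t => f t) k
  exact ⟨L, hL, fun k => (s k).1.1, fun k => (s k).1.2, fun k => ⟨(s k).2, hf (s k)⟩⟩

/-- The roots of the successive colorings form `q`; the path of step `k` consists of the latest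
roots, once enough steps have been made. -/
theorem exists_isRotation [Finite V] (hG : G.Connected)
    (hbad : ∀ c, Proper G c → ∃ x, ¬ Good G c x) (h2 : ¬ G.Colorable 2)
    {c : V → ZMod 3} (hc : Proper G c) :
    ∃ L, 5 ≤ L ∧ L % 3 = 2 ∧ ∃ q D, IsRotation G L q D := by
  classical
  obtain ⟨L, hL, c, p, h⟩ := exists_isRooted_seq hG hbad h2 hc
  choose hr x hx hadj hcs hps using h
  have hq : ∀ k, p (k + 1) L = x k := fun k => by rw [hps]; simp [advance]
  have hshift : ∀ m k, m ≤ L → p (k + m) (L - m) = p k L := by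
    intro m
    induction m with
    | zero => simp
    | succ m ih =>
      intro k hm
      rw [← ih k (by lia), ← add_assoc, hps, advance, if_pos (by lia),
        show L - (m + 1) + 1 = L - m by lia]
  have hpath : ∀ k i, k ≤ i + L → i + 1 ≤ k → Arc G (c k) (p i L) (p (i + 1) L) := by
    intro k i h1 h2
    have h3 := hshift (k - i) i (by lia)
    have h4 := hshift (k - (i + 1)) (i + 1) (by lia)
    rw [show i + (k - i) = k by lia] at h3
    rw [show i + 1 + (k - (i + 1)) = k by lia] at h4
    have h5 := (hr k).path (L - (k - i)) (by lia)
    rwa [show L - (k - i) + 1 = L - (k - (i + 1)) by lia, h3, h4] at h5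
  -- From `p 0 0` to the root the color rises by `L` along the path and by `2` through the stuck
  -- vertex.
  have hmod : L % 3 = 2 := by
    have e1 : ∀ i ≤ L, c 0 (p 0 i) = c 0 (p 0 0) + i := by
      intro i
      induction i with
      | zero => simp
      | succ i ih =>
        intro hi
        rw [((hr 0).path i hi).2, ih (by lia)]; push_cast; ring
    have hne : p 0 0 ≠ p 0 L := fun e => (hr 0).not_arc _ (e ▸ (hr 0).path 0 (by lia))
    have e2 := (hx 0).source _ (hadj 0) hne _ (hadj 0)
    have e3 := (hx 0).arc.2
    rw [e1 L le_rfl, e2] at e3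
    have e4 : ((L : ℕ) : ZMod 3) = ((2 : ℕ) : ZMod 3) := by
      push_cast; linear_combination e3
    exact (ZMod.natCast_eq_natCast_iff' _ _ _).1 e4
  -- `D k` raises the sink by one, which turns it into a source. Now all neighbors of the next root,
  -- including the old root, are sources, and a step lowers exactly these.
  refine ⟨L, by lia, hmod, fun k => p k L, fun k v => if v = p k L then c k v + 1 else c k v, ?_⟩
  have hsinkc : ∀ k w, G.Adj (p k L) w → c k (p k L) = c k w + 1 := fun k w hw =>
    (((hr k).proper.arc_or_arc hw).resolve_left ((hr k).not_arc w)).2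
  have hsrc : ∀ k w, G.Adj (p k L) w → c k w = c k (p k L) + 1 + 1 := fun k w hw => by
    linear_combination - hsinkc k w hw - three_eq_zero
  refine ⟨fun k u v huv => ?_, fun k v w hv hw => ?_, fun k v => ?_, fun k i h1 h2 => ?_,
    fun k => ?_, fun k => ?_, fun k v hv hna => ?_⟩
  · by_cases hu : u = p k L
    · have hv : v ≠ p k L := fun e => huv.ne (hu.trans e.symm)
      subst hu
      simp [hv, hsrc k v huv]
    · by_cases hv : v = p k L
      · subst hv
        simp [hu, hsrc k u huv.symm]
      · simp [hu, hv, (hr k).proper huv]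
  · rw [hq] at hv
    by_cases hvk : v = p k L
    · have hwk : w ≠ p k L := fun e => hw.ne (hvk.trans e.symm)
      subst hvk
      simp [hwk, hsrc k w hw]
    · have hs := (hx k).source v hv hvk
      have hwk : w ≠ p k L := by
        rintro rfl
        have e1 := hs _ hw
        have e2 := hs _ hv
        have e3 := (hx k).arc.2
        rw [e1, e2] at e3
        simp at e3
      simp [hvk, hwk, hs w hw]
  · rw [hq, hcs]
    have hxk : x k ≠ p k L := (hx k).arc.1.ne
    by_cases hvx : v = x k
    · subst hvx
      rw [lower_of_mem (show x k ∈ nearSet G (p k L) (x k) from Or.inl rfl)]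
      simp [hxk]
    · by_cases hvk : v = p k L
      · subst hvk
        have : p k L ∉ nearSet G (p k L) (x k) := by
          rintro (e | e)
          · exact hvx e
          · exact e.2 rfl
        rw [lower_of_notMem this]
        simp [hvx, (hx k).arc.1.symm]
      · by_cases ha : G.Adj v (x k)
        · rw [lower_of_mem (show v ∈ nearSet G (p k L) (x k) from Or.inr ⟨ha, hvk⟩)]
          simp [hvx, hvk, ha]
        · have : v ∉ nearSet G (p k L) (x k) := by
            rintro (e | e)
            · exact hvx e
            · exact ha e.1
          rw [lower_of_notMem this]
          simp [hvx, hvk, ha]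
  · have e1 := hpath k i h1 (by lia)
    have e2 := hpath k (i + 1) (by lia) (by lia)
    have n1 : p i L ≠ p k L := fun e => (hr k).not_arc _ (e ▸ e1)
    have n2 : p (i + 1) L ≠ p k L := fun e => (hr k).not_arc _ (e ▸ e2)
    simp [n1, n2, e1.2]
  · simp only [hq]
    exact (hx k).arc.1.symm
  · have := hshift L k le_rfl
    simp only [hq, Nat.sub_self] at this ⊢
    rw [← this]
    exact hadj (k + L)
  · obtain ⟨w, hw⟩ := (hr k).exists_arc v hv
    have hwk : w ≠ p k L := fun e => hna (e ▸ hw.1)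
    exact ⟨w, hw.1, by simp [hv, hwk, hw.2]⟩

/-! ### Adjacencies to the sequence. -/

namespace IsRotation

variable {L : ℕ} {q : ℕ → V} {D : ℕ → V → ZMod 3}

theorem succ_of_adj (h : IsRotation G L q D) {k : ℕ} {v : V} (hv : G.Adj v (q (k + 1))) :
    D (k + 1) v = D k v - 1 := by rw [h.succ, if_pos hv]

theorem succ_of_not_adj (h : IsRotation G L q D) {k : ℕ} {v : V} (hv : ¬ G.Adj v (q (k + 1))) :
    D (k + 1) v = D k v := by rw [h.succ, if_neg hv]

theorem eq_of_forall_not_adj (h : IsRotation G L q D) {k m : ℕ} {v : V} (hkm : k ≤ m)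
    (hv : ∀ i, k < i → i ≤ m → ¬ G.Adj v (q i)) : D m v = D k v := by
  induction m, hkm using Nat.le_induction with
  | base => rfl
  | succ m hkm ih =>
    rw [h.succ_of_not_adj (hv (m + 1) (by lia) le_rfl), ih fun i h1 h2 => hv i h1 (by lia)]

theorem eq_sub_one (h : IsRotation G L q D) {k j m : ℕ} {v : V} (hkj : k < j) (hjm : j ≤ m)
    (hj : G.Adj v (q j)) (hv : ∀ i, k < i → i ≤ m → i ≠ j → ¬ G.Adj v (q i)) :
    D m v = D k v - 1 := by
  obtain ⟨j, rfl⟩ := Nat.exists_eq_add_one_of_ne_zero (show j ≠ 0 by lia)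
  rw [h.eq_of_forall_not_adj hjm fun i h1 h2 => hv i (by lia) h2 (by lia), h.succ_of_adj hj,
    h.eq_of_forall_not_adj (show k ≤ j by lia) fun i h1 h2 => hv i h1 (by lia) (by lia)]

theorem path_add (h : IsRotation G L q D) {k i : ℕ} (h1 : k ≤ i + L) (s : ℕ)
    (h2 : i + s + 1 ≤ k) : D k (q (i + s)) = D k (q i) + s := by
  induction s with
  | zero => simp
  | succ s ih =>
    rw [← add_assoc, h.path k (i + s) (by lia) (by lia), ih (by lia)]
    push_cast; ring

/-- Both `v` and `q j` would be neighbors of `q (j + 1)`, hence sources for `D j`, but sources are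
not adjacent. -/
theorem not_adj_succ (h : IsRotation G L q D) {j : ℕ} {v : V} (hj : G.Adj v (q j)) :
    ¬ G.Adj v (q (j + 1)) := by
  intro hv
  have e1 := h.source j v _ hv hj
  have e2 := h.source j _ _ (h.adj_succ j) hj.symm
  rw [e1] at e2
  generalize D j v = a at e2
  revert a; decide

/-- Two adjacencies of `v` to the sequence, at most `L + 1` steps apart, are at a distance that
is `2` modulo `3`. -/
theorem mod_three_of_adj (h : IsRotation G L q D) {j t : ℕ} {v : V} (hj : G.Adj v (q j))
    (ht : G.Adj v (q (j + t))) (h1 : 1 ≤ t) (h2 : t ≤ L + 1) : t % 3 = 2 := by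
  rcases h1.eq_or_lt with rfl | h1
  · exact absurd ht (h.not_adj_succ hj)
  obtain ⟨s, rfl⟩ := Nat.exists_eq_add_of_le h1
  have e : j + (1 + 1 + s) = j + s + 1 + 1 := by ring
  rw [e] at ht
  have e1 := h.source _ _ _ ht hj
  have e2 := h.source _ _ _ ht ht
  have e3 := h.source (j + s + 1) _ _ (h.adj_succ _) (h.adj_succ _)
  have e4 := h.source (j + s + 1) _ _ (h.adj_succ _) (h.adj_succ (j + s)).symm
  have e5 := h.path_add (k := j + s + 1) (i := j) (by lia) s le_rfl
  have e6 : ((s : ℕ) : ZMod 3) = ((0 : ℕ) : ZMod 3) := by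
    push_cast
    linear_combination - e5 - e1 + e2 + e4 - e3
  have := (ZMod.natCast_eq_natCast_iff' _ _ _).1 e6
  lia

/-- A vertex is adjacent to at most two of `L + 2` consecutive terms of the sequence. -/
theorem not_adj_three (h : IsRotation G L q D) {i j k : ℕ} {v : V} (hi : G.Adj v (q i))
    (hj : G.Adj v (q j)) (hk : G.Adj v (q k)) (hij : i < j) (hjk : j < k)
    (hki : k ≤ i + L + 1) : False := by
  obtain ⟨s, rfl⟩ := Nat.exists_eq_add_of_lt hij
  obtain ⟨t, rfl⟩ := Nat.exists_eq_add_of_lt hjk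
  have h1 := h.mod_three_of_adj (t := s + 1) hi hj (by lia) (by lia)
  have h2 := h.mod_three_of_adj (t := t + 1) hj hk (by lia) (by lia)
  have h3 := h.mod_three_of_adj (t := s + 1 + (t + 1)) hi
    (by rwa [show i + (s + 1 + (t + 1)) = i + s + 1 + t + 1 by ring]) (by lia) (by lia)
  -- Two gaps that are `2` modulo `3` add up to `1`, not `2`.
  lia

theorem root_source (h : IsRotation G L q D) {k : ℕ} {w : V} (hw : G.Adj (q k) w) :
    D k w = D k (q k) + 1 := h.source k _ _ (h.adj_succ k) hw

/-- The next adjacency of a vertex to the sequence comes after at most `L` steps. -/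
theorem exists_adj_add (h : IsRotation G L q D) (hL : 5 ≤ L) {j : ℕ} {v : V}
    (hj : G.Adj v (q j)) : ∃ t, 2 ≤ t ∧ t ≤ L ∧ t % 3 = 2 ∧ G.Adj v (q (j + t)) := by
  -- Otherwise `v` keeps its color from `D j` to `D (j + L)` while `q j` is lowered exactly once.
  -- But `q j` is a source for both colorings, so its color difference to `v` cannot change.
  have hex : ∃ i, j < i ∧ i ≤ j + L ∧ G.Adj v (q i) := by
    by_contra hno
    push Not at hno
    have e1 := h.eq_of_forall_not_adj (Nat.le_add_right j L) hno
    have e2 := h.eq_sub_one (v := q j) (show j < j + 1 by lia) (show j + 1 ≤ j + L by lia)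
      (h.adj_succ j) fun i h1 h2 h3 h4 =>
        h.not_adj_three (h.adj_succ j) h4 (h.adj_add j) (by lia) (by lia) (by lia)
    have e3 := h.source (j + L) _ _ (h.adj_add j) hj.symm
    have e4 := h.root_source hj.symm
    rw [e1, e2, e4] at e3
    generalize D j (q j) = a at e3
    revert a; decide
  obtain ⟨i, h1, h2, h3⟩ := hex
  obtain ⟨t, rfl⟩ := Nat.exists_eq_add_of_lt h1
  have := h.mod_three_of_adj (t := t + 1) hj h3 (by lia) (by lia)
  exact ⟨t + 1, by lia, by lia, this, h3⟩

/-- By `not_adj_three`, the only lowering of this vertex in the interval is the one at its neighbor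
`q (k + s)`. -/
theorem apply_add_succ (h : IsRotation G L q D) {k s : ℕ} (hs : 1 ≤ s) (hsL : s ≤ L) :
    D (k + s) (q (k + s + 1)) = D k (q (k + s + 1)) - 1 :=
  h.eq_sub_one (show k < k + s by lia) le_rfl (h.adj_succ _).symm fun i h1 h2 h3 h4 =>
    h.not_adj_three h4 (h.adj_succ (k + s)).symm (h.adj_succ (k + s + 1)) (by lia) (by lia)
      (by lia)

/-- Later terms of the sequence form a directed path for `D k`. -/
theorem path_later (h : IsRotation G L q D) {k s : ℕ} (hs : 2 ≤ s) (hsL : s ≤ L) :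
    D k (q (k + s + 1)) = D k (q (k + s)) + 1 := by
  have e1 := h.apply_add_succ (k := k) (show 1 ≤ s by lia) hsL
  have e2 : D (k + s) (q (k + s)) = D k (q (k + s)) - 1 := by
    obtain ⟨r, rfl⟩ : ∃ r, s = r + 1 := ⟨s - 1, by lia⟩
    exact h.eq_sub_one (show k < k + r by lia) (by lia) (h.adj_succ (k + r)).symm
      fun i h1 h2 h3 h4 => by
        rcases h2.eq_or_lt with rfl | h2
        · exact h4.ne rfl
        · exact h.not_adj_three h4 (h.adj_succ (k + r)).symm (h.adj_succ (k + r + 1))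
            (by lia) (by lia) (by lia)
  have e3 := h.root_source (h.adj_succ (k + s))
  linear_combination e3 - e1 + e2

/-- As `2 = -1`, a vertex `v` with the same color in `D k` and `D (k + s)` receives an arc from `q
(k + s + 1)` in `D k`. -/
theorem apply_later (h : IsRotation G L q D) {k s : ℕ} (hs : 1 ≤ s) (hsL : s ≤ L) {v : V}
    (hv : G.Adj v (q (k + s + 1))) : D k (q (k + s + 1)) = D (k + s) v + 2 := by
  have e1 := h.apply_add_succ (k := k) hs hsL
  have e2 := h.source _ _ _ hv hv
  linear_combination e2 - e1

/-! ### Recoloring at an edge that leaves the sequence. -/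

/-- A vertex `b` leaving the sequence at `q (k + 3)` gives a coloring in which all vertices
are good: raise `q (k + 1)` and lower `b` in `D (k + 2)`. -/
theorem exists_good_of_adj (h : IsRotation G L q D) (hL : 5 ≤ L) {k : ℕ} (hk : 3 ≤ k) {b : V}
    (hb3 : G.Adj b (q (k + 3))) (hb2 : b ≠ q (k + 2)) (hb1 : ¬ G.Adj b (q (k + 1)))
    (hb4 : b ≠ q (k + 4) ∨ ∀ v, G.Adj v (q k) → ¬ G.Adj v (q (k + 5))) :
    ∃ e, Proper G e ∧ ∀ x, Good G e x := by
  classical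
  have hx2 : G.Adj (q (k + 1)) (q (k + 2)) := h.adj_succ (k + 1)
  have hx3 : ¬ G.Adj (q (k + 1)) (q (k + 3)) := h.not_adj_succ hx2
  have hbx : b ≠ q (k + 1) := fun e => hx3 (e ▸ hb3)
  have hbq : ¬ G.Adj b (q (k + 2)) := fun e => h.not_adj_succ e hb3
  have hbr : b ≠ q k := fun e => hb1 (e ▸ h.adj_succ k)
  have h12 : G.Adj (q (k + 2)) (q (k + 3)) := h.adj_succ (k + 2)
  -- In `D (k + 2)` the vertex `q (k + 1)` is a sink and `b` is a source. The change swaps these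
  -- roles and creates the directed path `q (k + 1)`, `q (k + 2)`, `q (k + 3)`, `b`.
  obtain ⟨e, he⟩ : ∃ e : V → ZMod 3, ∀ v, e v = D (k + 2) v +
    (if v = q (k + 1) then 1 else 0) - (if v = b then 1 else 0) := ⟨_, fun v => rfl⟩
  have heq : ∀ v, v ≠ q (k + 1) → v ≠ b → e v = D (k + 2) v := by
    intro v h1 h2; rw [he, if_neg h1, if_neg h2]; ring
  have hex : e (q (k + 1)) = D (k + 2) (q (k + 1)) + 1 := by
    rw [he, if_pos rfl, if_neg hbx.symm]; ring
  have heb : e b = D (k + 2) b - 1 := by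
    rw [he, if_pos rfl, if_neg hbx]; ring
  have hD2 : ∀ v, ¬ G.Adj v (q (k + 1)) → ¬ G.Adj v (q (k + 2)) → D (k + 2) v = D k v := by
    intro v h1 h2
    rw [h.succ_of_not_adj h2, h.succ_of_not_adj h1]
  have harcx : ∀ w, G.Adj (q (k + 1)) w → Arc G e (q (k + 1)) w := by
    intro w hw
    have hw2 : ¬ G.Adj w (q (k + 2)) := h.not_adj_succ hw.symm
    have e1 := h.root_source hw
    have e2 := h.succ_of_adj hx2
    have e3 := h.succ_of_not_adj hw2
    refine ⟨hw, ?_⟩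
    rw [hex, heq w hw.ne' (fun e' => hb1 (e' ▸ hw.symm))]
    linear_combination e1 + e3 - e2
  have harcb : ∀ w, G.Adj w b → Arc G e w b := by
    intro w hw
    have e1 := h.source (k + 2) b w hb3 hw.symm
    refine ⟨hw, ?_⟩
    rw [heb, heq w (fun e' => hb1 (e' ▸ hw.symm)) hw.ne]
    linear_combination -e1 - three_eq_zero
  have harc2 : ∀ v, G.Adj (q (k + 2)) v → v ≠ q (k + 1) → Arc G e (q (k + 2)) v := by
    intro v hv hvx
    refine ⟨hv, ?_⟩
    rw [heq v hvx (fun e' => hbq (e' ▸ hv.symm)), heq _ hx2.ne' hb2.symm, h.root_source hv]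
  have h3x : q (k + 3) ≠ q (k + 1) := fun e' => hb1 (e' ▸ hb3)
  have harc23 : Arc G e (q (k + 2)) (q (k + 3)) := harc2 _ h12 h3x
  have harc3 : ∀ v, G.Adj v (q (k + 3)) → v ≠ b → Arc G e v (q (k + 3)) := by
    intro v hv hvb
    refine ⟨hv, ?_⟩
    rw [heq v (fun e' => hx3 (e' ▸ hv)) hvb, heq _ h3x hb3.ne']
    exact h.source (k + 2) v _ hv hv
  have hproper : Proper G e := by
    refine Proper.of_arc_or_arc fun u v huv => ?_
    by_cases h1 : u = q (k + 1)
    · subst h1; exact Or.inl (harcx v huv)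
    by_cases h2 : v = q (k + 1)
    · subst h2; exact Or.inr (harcx u huv.symm)
    by_cases h3 : u = b
    · subst h3; exact Or.inr (harcb v huv.symm)
    by_cases h4 : v = b
    · subst h4; exact Or.inl (harcb u huv)
    have e1 := heq u h1 h3
    have e2 := heq v h2 h4
    rcases (h.proper (k + 2)).arc_or_arc huv with h' | h'
    · exact Or.inl ⟨huv, by rw [e1, e2, h'.2]⟩
    · exact Or.inr ⟨huv.symm, by rw [e1, e2, h'.2]⟩
  have hlate : ∀ s, 4 ≤ s → s ≤ L + 1 → q (k + s) ≠ b → e (q (k + s)) = D k (q (k + s)) := by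
    intro s h4 hs hsb
    have hno : ∀ i, k + 1 ≤ i → i ≤ k + 2 → ¬ G.Adj (q (k + s)) (q i) := by
      intro i h1 h2 hi
      obtain ⟨r, rfl⟩ : ∃ r, s = r + 1 := ⟨s - 1, by lia⟩
      exact h.not_adj_three hi (h.adj_succ (k + r)).symm (h.adj_succ (k + r + 1))
        (by lia) (by lia) (by lia)
    have hsx : q (k + s) ≠ q (k + 1) := fun e' => hno (k + 2) (by lia) le_rfl (e' ▸ hx2)
    rw [heq _ hsx hsb,
      hD2 _ (hno _ le_rfl (by lia)) (hno _ (by lia) le_rfl)]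
  -- A later term equal to `b` would have three close neighbors in the sequence. For `s = 4` two of
  -- them coincide, so this case needs `hb4`.
  have hlate_ne : ∀ s, 5 ≤ s → s ≤ L + 1 → q (k + s) ≠ b := by
    rintro s h5 hs rfl
    obtain ⟨r, rfl⟩ : ∃ r, s = r + 1 := ⟨s - 1, by lia⟩
    exact h.not_adj_three hb3 (h.adj_succ (k + r)).symm (h.adj_succ (k + r + 1))
      (by lia) (by lia) (by lia)
  have hgood_late : ∀ s v, 4 ≤ s → s ≤ L → G.Adj v (q (k + s + 1)) →
      (∀ i, k + 2 < i → i ≤ k + s → ¬ G.Adj v (q i)) → v ≠ q (k + 1) → v ≠ b →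
      q (k + s) ≠ b → Good G e v := by
    intro s v h4 hs hv hno hvx hvb hsb
    have e1 := h.apply_later (show 1 ≤ s by lia) hs hv
    have e2 := h.eq_of_forall_not_adj (show k + 2 ≤ k + s by lia) hno
    have e3 := hlate s h4 (by lia) hsb
    have e4 := hlate (s + 1) (by lia) (by lia) (hlate_ne _ (by lia) (by lia))
    have e5 := h.path_later (k := k) (show 2 ≤ s by lia) hs
    have e6 := heq v hvx hvb
    rw [← add_assoc] at e4
    refine Or.inr ⟨q (k + s + 1), q (k + s), ⟨h.adj_succ _, ?_⟩, ⟨hv.symm, ?_⟩⟩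
    · rw [e3, e4, e5]
    · rw [e4, e6]
      linear_combination -e1 - e2 - three_eq_zero
  have hfree : ∀ v, ¬ G.Adj v (q (k + 1)) → ¬ G.Adj v (q (k + 2)) → v ≠ b → v ≠ q (k + 1) →
      e v = D k v := fun v h1 h2 h3 h4 => by rw [heq v h4 h3, hD2 v h1 h2]
  -- Away from the roots `q k`, `q (k + 1)`, `q (k + 2)` and from `b`, out-arcs of `D k` survive:
  -- their heads cannot be vertices that were sources when lowered.
  have hnext : ∀ v, ¬ G.Adj v (q k) → ¬ G.Adj v (q (k + 1)) → ¬ G.Adj v (q (k + 2)) → v ≠ b →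
      v ≠ q (k + 1) → v ≠ q k → ∃ w, Arc G e v w ∧ ¬ G.Adj w (q (k + 1)) ∧
        ¬ G.Adj w (q (k + 2)) ∧ w ≠ b ∧ w ≠ q (k + 1) ∧ w ≠ q k := by
    intro v h0 h1 h2 h3 h4 h5
    obtain ⟨w, hw⟩ := h.exists_arc k v h5 h0
    have hw1 : ¬ G.Adj w (q (k + 1)) := fun hw1 =>
      hw.ne_add_one (h.source k w v hw1 hw.1.symm)
    have hw2 : ¬ G.Adj w (q (k + 2)) := by
      intro hw2
      have e1 := h.source (k + 1) w v hw2 hw.1.symm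
      rw [h.succ_of_not_adj h1, h.succ_of_not_adj hw1] at e1
      exact hw.ne_add_one e1
    have hwb : w ≠ b := by
      rintro rfl
      have e1 := h.source (k + 2) w v hb3 hw.1.symm
      rw [hD2 v h1 h2, hD2 w hw1 hw2] at e1
      exact hw.ne_add_one e1
    have hwx : w ≠ q (k + 1) := fun e' => h1 (e' ▸ hw.1)
    refine ⟨w, ⟨hw.1, ?_⟩, hw1, hw2, hwb, hwx, fun e' => h0 (e' ▸ hw.1)⟩
    rw [hfree v h1 h2 h3 h4, hfree w hw1 hw2 hwb hwx, hw.2]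
  have her : e (q k) = D k (q k) - 1 := by
    have hr1 := h.adj_succ k
    rw [heq _ hr1.ne hbr.symm, h.succ_of_not_adj (h.not_adj_succ hr1), h.succ_of_adj hr1]
  refine ⟨e, hproper, fun v => ?_⟩
  by_cases hvx : v = q (k + 1)
  · subst hvx; exact Or.inl ⟨_, _, harcx _ hx2, harc23⟩
  by_cases hvb : v = b
  · subst hvb; exact Or.inr ⟨_, _, harc23, harcb _ hb3.symm⟩
  by_cases hv2 : G.Adj v (q (k + 2))
  · exact Or.inr ⟨_, _, harcx _ hx2, harc2 v hv2.symm hvx⟩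
  by_cases hvr : v = q k
  · subst hvr
    -- The old root ends the older path through `q (k - 2)` and `q (k - 1)`, whose colors have not
    -- changed since `D k`.
    obtain ⟨k, rfl⟩ : ∃ m, k = m + 3 := ⟨k - 3, by lia⟩
    have hno2 : ∀ i, k + 4 ≤ i → i ≤ k + 6 → ¬ G.Adj (q (k + 2)) (q i) := fun i h1 h2 hi =>
      h.not_adj_three (h.adj_succ (k + 1)).symm (h.adj_succ (k + 2)) hi (by lia) (by lia) (by lia)
    have hno1 : ∀ i, k + 4 ≤ i → i ≤ k + 6 → ¬ G.Adj (q (k + 1)) (q i) := fun i h1 h2 hi =>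
      h.not_adj_three (h.adj_succ k).symm (h.adj_succ (k + 1)) hi (by lia) (by lia) (by lia)
    have e2 := hfree (q (k + 2)) (hno2 _ le_rfl (by lia)) (hno2 _ (by lia) (by lia))
      (fun e' => hno2 _ (by lia) le_rfl (e' ▸ hb3)) (fun e' => hno2 _ (by lia) (by lia) (e' ▸ hx2))
    have e1 := hfree (q (k + 1)) (hno1 _ le_rfl (by lia)) (hno1 _ (by lia) (by lia))
      (fun e' => hno1 _ (by lia) le_rfl (e' ▸ hb3)) (fun e' => hno1 _ (by lia) (by lia) (e' ▸ hx2))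
    refine Or.inr ⟨q (k + 2), q (k + 1), ⟨h.adj_succ _, ?_⟩, ⟨h.adj_succ _, ?_⟩⟩
    · rw [e1, e2, h.path (k + 3) (k + 1) (by lia) (by lia)]
    · have e3 := h.root_source (h.adj_succ (k + 2)).symm
      rw [e2, her]
      linear_combination -e3 - three_eq_zero
  by_cases hv1 : G.Adj v (q (k + 1))
  -- The next adjacency either is to `q (k + 3)`, giving a path out to `b`, or lies far ahead, where
  -- the later terms give a path into `v`.
  · obtain ⟨t, ht2, htL, htm, ht⟩ := h.exists_adj_add hL hv1
    by_cases ht' : t = 2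
    · subst ht'
      exact Or.inl ⟨_, _, harc3 v ht hvb, harcb _ hb3.symm⟩
    · have ht5 : 5 ≤ t := by lia
      rw [show k + 1 + t = k + t + 1 by ring] at ht
      refine hgood_late t v (by lia) htL ht (fun i h1 h2 hi => ?_) hvx hvb
        (hlate_ne t ht5 (by lia))
      exact h.not_adj_three hv1 hi ht (by lia) (by lia) (by lia)
  by_cases hv0 : G.Adj v (q k)
  · obtain ⟨t, ht2, htL, htm, ht⟩ := h.exists_adj_add hL hv0
    have ht' : t ≠ 2 := fun e' => hv2 (e' ▸ ht)
    obtain ⟨s, rfl⟩ : ∃ s, t = s + 1 := ⟨t - 1, by lia⟩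
    refine hgood_late s v (by lia) (by lia) ht (fun i h1 h2 hi => ?_) hvx hvb ?_
    · exact h.not_adj_three hv0 hi ht (by lia) (by lia) (by lia)
    · by_cases hs : s = 4
      · subst hs
        rcases hb4 with hb4 | hb4
        · exact hb4.symm
        · exact absurd ht (hb4 v hv0)
      · exact hlate_ne s (by lia) (by lia)
  obtain ⟨w, hvw, hw1, hw2, hwb, hwx, hwr⟩ := hnext v hv0 hv1 hv2 hvb hvx hvr
  -- The root `q k` has been lowered once since `D k`, so arcs between it and such a `w` now enter
  -- it.
  by_cases hw0 : G.Adj w (q k)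
  · refine Or.inl ⟨w, q k, hvw, hw0, ?_⟩
    have e1 := h.root_source hw0.symm
    rw [her, hfree w hw1 hw2 hwb hwx]
    linear_combination -e1 - three_eq_zero
  · obtain ⟨z, hwz, -⟩ := hnext w hw0 hw1 hw2 hwb hwx hwr
    exact Or.inl ⟨w, z, hvw, hwz⟩

/-! ### Periodicity and the exceptional cycle. -/

/-- A rotation of period `7` that visits all vertices makes `G` a cycle. -/
theorem nonempty_iso_cycleGraph (h : IsRotation G 5 q D) (hper : Function.Periodic q 7)
    (hsurj : Function.Surjective q) : Nonempty (G ≃g cycleGraph 7) := by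
  have hnot : ∀ i t, 2 ≤ t → t ≤ 5 → ¬ G.Adj (q i) (q (i + t)) := by
    intro i t h1 h2 h3
    rw [← hper i, ← hper (i + t)] at h3
    exact h.not_adj_three (h.adj_succ (i + 6)).symm (h.adj_succ (i + 7)) h3 (by lia) (by lia)
      (by lia)
  have hadj6 : ∀ i, G.Adj (q i) (q (i + 6)) := fun i => h.adj_add i
  have hne : ∀ i t, 1 ≤ t → t ≤ 6 → q i ≠ q (i + t) := by
    intro i t h1 h2 e
    by_cases ht1 : t = 1
    · subst ht1; exact (h.adj_succ i).ne e
    by_cases ht6 : t = 6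
    · subst ht6; exact (hadj6 i).ne e
    by_cases ht5 : t = 5
    · subst ht5
      have := (h.adj_succ (i + 4)).symm
      rw [← e] at this
      exact hnot i 4 (by lia) (by lia) this
    · have := h.adj_succ (i + t)
      rw [← e] at this
      exact hnot i (t + 1) (by lia) (by lia) this
  have hcyc : ∀ a b : Fin 7, a < b →
      ((cycleGraph 7).Adj a b ↔ b.val = a.val + 1 ∨ b.val = a.val + 6) := by decide
  have hlt : ∀ a b : Fin 7, a < b → (G.Adj (q a) (q b) ↔ (cycleGraph 7).Adj a b) := by
    intro a b hab
    rw [hcyc a b hab]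
    obtain ⟨t, ht⟩ := Nat.exists_eq_add_of_lt (Fin.lt_def.1 hab)
    have hb := b.2
    rw [ht]
    constructor
    · intro h'
      by_contra hno
      exact hnot a (t + 1) (by lia) (by lia) h'
    · rintro (h' | h')
      · rw [h']; exact h.adj_succ _
      · rw [h']; exact hadj6 _
  let f : Fin 7 → V := fun a => q a
  have hf : Function.Bijective f := by
    constructor
    · intro a b e
      by_contra hab
      rcases lt_or_gt_of_ne hab with hlt | hlt
      · obtain ⟨t, ht⟩ := Nat.exists_eq_add_of_lt (Fin.lt_def.1 hlt)
        exact hne a (t + 1) (by lia) (by lia) (by rw [← add_assoc, ← ht]; exact e)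
      · obtain ⟨t, ht⟩ := Nat.exists_eq_add_of_lt (Fin.lt_def.1 hlt)
        exact hne b (t + 1) (by lia) (by lia) (by rw [← add_assoc, ← ht]; exact e.symm)
    · intro v
      obtain ⟨i, rfl⟩ := hsurj v
      exact ⟨⟨i % 7, Nat.mod_lt _ (by lia)⟩, hper.map_mod_nat i⟩
  refine ⟨RelIso.symm ⟨Equiv.ofBijective f hf, fun {a b} => ?_⟩⟩
  change G.Adj (q a) (q b) ↔ (cycleGraph 7).Adj a b
  rcases lt_trichotomy a b with hab | rfl | hab
  · exact hlt a b hab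
  · simp
  · rw [G.adj_comm, (cycleGraph 7).adj_comm]
    exact hlt b a hab

/-- When no recoloring succeeds, every edge leaving the sequence is in the exceptional case of
`exists_good_of_adj`. The edges of `adj_add` then force the period, and the common neighbor in the
exception excludes `L ≥ 8`. -/
theorem exists_good_or_iso (h : IsRotation G L q D) (hL : 5 ≤ L) (hm : L % 3 = 2)
    (hG : G.Connected) :
    (∃ e, Proper G e ∧ ∀ x, Good G e x) ∨ Nonempty (G ≃g cycleGraph 7) := by
  by_contra hcon
  rw [not_or] at hcon
  obtain ⟨hno, hiso⟩ := hcon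
  have hnear : ∀ k b, 3 ≤ k → G.Adj b (q (k + 3)) → b ≠ q (k + 2) → ¬ G.Adj b (q (k + 1)) →
      b = q (k + 4) ∧ ∃ v, G.Adj v (q k) ∧ G.Adj v (q (k + 5)) := by
    intro k b hk h3 h2 h1
    by_contra hb
    refine hno (h.exists_good_of_adj hL hk h3 h2 h1 ?_)
    by_contra hb'
    push Not at hb'
    exact hb hb'
  have hback : ∀ j, q j = q (j + L + 2) ∧
      ∃ v, G.Adj v (q (j + L - 2)) ∧ G.Adj v (q (j + L + 3)) := by
    intro j
    have h1 : ¬ G.Adj (q j) (q (j + L - 2 + 1)) := fun h' =>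
      h.not_adj_three (h.adj_succ j) h' (h.adj_add j) (by lia) (by lia) (by lia)
    have h2 : q j ≠ q (j + L - 2 + 2) := fun e => h1 (e ▸ (h.adj_succ _).symm)
    have h3 : G.Adj (q j) (q (j + L - 2 + 3)) := by
      rw [show j + L - 2 + 3 = j + L + 1 by lia]; exact h.adj_add j
    have := hnear (j + L - 2) (q j) (by lia) h3 h2 h1
    rwa [show j + L - 2 + 4 = j + L + 2 by lia, show j + L - 2 + 5 = j + L + 3 by lia] at this
  have hper : Function.Periodic q (L + 2) := fun j => (hback j).1.symm
  -- A neighbor of `q (k + 5)` outside the sequence is never exceptional, so it must also be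
  -- adjacent to `q (k + 3)` and then to `q (k + 1)`: one adjacency too many.
  have hclosed : ∀ i v, G.Adj (q i) v → ∃ j, q j = v := by
    intro i v hv
    by_contra hv'
    push Not at hv'
    obtain ⟨k, hk, hik⟩ : ∃ k, 3 ≤ k ∧ q i = q (k + 5) := by
      refine ⟨i + (L + 2) + (L + 2) - 5, by lia, ?_⟩
      rw [show i + (L + 2) + (L + 2) - 5 + 5 = i + (L + 2) + (L + 2) by lia, hper, hper]
    rw [hik] at hv
    have h1 : G.Adj v (q (k + 3)) := by
      by_contra h'
      exact hv' _ (hnear (k + 2) v (by lia) hv.symm (hv' _).symm h').1.symm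
    have h2 : G.Adj v (q (k + 1)) := by
      by_contra h'
      exact hv' _ (hnear k v hk h1 (hv' _).symm h').1.symm
    exact h.not_adj_three h2 h1 hv.symm (by lia) (by lia) (by lia)
  have hsurj : Function.Surjective q := by
    intro v
    by_contra hv
    obtain ⟨p⟩ := hG.preconnected (q 0) v
    obtain ⟨d, -, ⟨i, hi⟩, hd⟩ := p.exists_boundary_dart (Set.range q) ⟨0, rfl⟩ hv
    exact hd (hclosed i _ (hi ▸ d.adj))
  by_cases hL5 : L = 5
  · subst hL5
    exact hiso (h.nonempty_iso_cycleGraph hper hsurj)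
  have hL8 : 8 ≤ L := by lia
  have hwin : ∀ v N, ∃ i, N < i ∧ i ≤ N + (L + 2) ∧ q i = v := by
    intro v N
    induction N with
    | zero =>
      obtain ⟨j, rfl⟩ := hsurj v
      have hj := Nat.mod_lt j (show 0 < L + 2 by lia)
      by_cases h0 : j % (L + 2) = 0
      · refine ⟨L + 2, by lia, by lia, ?_⟩
        rw [← hper.map_mod_nat j, h0, ← hper 0, zero_add]
      · exact ⟨j % (L + 2), by lia, by lia, hper.map_mod_nat j⟩
    | succ N ih =>
      obtain ⟨i, h1, h2, h3⟩ := ih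
      by_cases hi : i = N + 1
      · exact ⟨i + (L + 2), by lia, by lia, by rw [hper, h3]⟩
      · exact ⟨i, by lia, by lia, h3⟩
  -- The common neighbor is itself some `q i`, adjacent also to both its neighbors in the sequence.
  -- Wherever `i` lies within a period, this gives three close adjacencies or a loop.
  obtain ⟨-, v, hv0, hv5⟩ := hback 0
  obtain ⟨k, hk⟩ : ∃ k, 0 + L - 2 = k + 1 := ⟨L - 3, by lia⟩
  rw [hk] at hv0
  rw [show 0 + L + 3 = k + 6 by lia] at hv5
  obtain ⟨i, hi1, hi2, rfl⟩ := hwin v (k + 1)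
  obtain ⟨a, rfl⟩ : ∃ a, i = k + 2 + a := ⟨i - (k + 2), by lia⟩
  have hprev : G.Adj (q (k + 2 + a)) (q (k + 1 + a)) := by
    rw [show k + 2 + a = k + 1 + a + 1 by ring]; exact (h.adj_succ _).symm
  have hnext := h.adj_succ (k + 2 + a)
  by_cases ha0 : a = 0
  · subst ha0
    exact h.not_adj_three hprev hnext hv5 (by lia) (by lia) (by lia)
  by_cases ha : a < L
  · exact h.not_adj_three hv0 hprev hnext (by lia) (by lia) (by lia)
  by_cases haL : a = L
  · subst haL
    have e := hper k
    rw [show k + (a + 2) = k + 2 + a by ring] at e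
    rw [e] at hv0 hv5
    obtain ⟨m, rfl⟩ : ∃ m, k = m + 1 := ⟨k - 1, by lia⟩
    -- The span here is `7`, within `L + 1` only because `L ≠ 5`; in the 7-cycle the two outer terms
    -- coincide.
    exact h.not_adj_three (h.adj_succ m).symm hv0 hv5 (by lia) (by lia) (by lia)
  · obtain rfl : a = L + 1 := by lia
    have e := hper (k + 1)
    rw [show k + 1 + (L + 2) = k + 2 + (L + 1) by ring] at e
    exact hv0.ne e

end IsRotation

end ThreeColoring

theorem theorem1 {V : Type*} [Finite V] (G : SimpleGraph V) (hconn : G.Connected)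
    (hchi : G.chromaticNumber = 3) (hC7 : IsEmpty (G ≃g SimpleGraph.cycleGraph 7)) :
    ∃ c : G.Coloring (Fin 3), ∀ x : V, ∃ (y : V) (p : G.Walk x y),
      SimpleGraph.IsColorfulPath c p := by
  suffices hgood : ∃ c, ThreeColoring.Proper G c ∧ ∀ x, ThreeColoring.Good G c x by
    obtain ⟨c, hc, hg⟩ := hgood
    exact ThreeColoring.exists_colorful_of_good hc hg
  have h3 : G.Colorable 3 := SimpleGraph.chromaticNumber_le_iff_colorable.1 hchi.le
  have h2 : ¬ G.Colorable 2 := by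
    intro h
    have := SimpleGraph.chromaticNumber_le_iff_colorable.2 h
    rw [hchi] at this
    exact absurd this (by decide)
  obtain ⟨C⟩ := h3
  have hC : ThreeColoring.Proper G (fun v => (C v : ZMod 3)) := fun u v h => C.valid h
  by_contra hno
  have hbad : ∀ c, ThreeColoring.Proper G c → ∃ x, ¬ ThreeColoring.Good G c x := by
    intro c hc
    by_contra h
    push Not at h
    exact hno ⟨c, hc, h⟩
  obtain ⟨L, hL, hm, q, D, h⟩ := ThreeColoring.exists_isRotation hconn hbad h2 hC
  rcases h.exists_good_or_iso hL hm hconn with h | ⟨⟨f⟩⟩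
  · exact hno h
  · exact hC7.false f
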